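/- Let $\mathcal H$ be a complex Hilbert space and let $\mathcal P=\{P\in\mathcal L(\mathcal H) : P=P^*=P^2\}$ be the set of orthogonal projections on $\mathcal H$, with the metric $\|P-Q\|$ induced by the operator norm. The length of a continuous path $\gamma\colon[a,b]\to\mathcal P$ is $$l(\gamma)=\sup\Bigl\{\sum_{j=0}^{n-1}\|\gamma(t_{j+1})-\gamma(t_j)\| : n\in\mathbb N,\ a=t_0<\dots<t_n=b\Bigr\}\in[0,\infty],$$ and $\gamma$ is rectifiable if $l(\gamma)<\infty$. A path $\gamma\colon[a,b]\to\mathcal P$ is piecewise $C^1$-smooth if there is a partition $a=t_0<\dots<t_n=b$ such that $\gamma|_{[t_j,t_{j+1}]}$ is $C^1$-smooth for every $j\in\{0,\dots,n-1\}$. For $P,Q\in\mathcal P$ let $\rho(P,Q)\in[0,\infty]$ be the infimum of $l(\gamma)$ over all rectifiable continuous paths $\gamma$ in $\mathcal P$ from $P$ to $Q$, and let $\rho_R(P,Q)\in[0,\infty]$ be the infimum of $\int_a^b\|\dot\gamma(t)\|\,dt$ over all piecewise $C^1$-smooth paths $\gamma\colon[a,b]\to\mathcal P$ from $P$ to $Q$;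 each infimum is $\infty$ if there are no such paths. Let $\gamma\colon[a,b]\to\mathcal P$ be a continuous path. Then there is a sequence $(\gamma_n)$ of piecewise $C^1$-smooth paths $\gamma_n\colon[a,b]\to\mathcal P$, each having the same endpoints as $\gamma$ (that is, $\gamma_n(a)=\gamma(a)$ and $\gamma_n(b)=\gamma(b)$), such that $\gamma_n$ converges to $\gamma$ uniformly on $[a,b]$ and $l(\gamma_n)$ converges to $l(\gamma)$ in $[0,\infty]$. Moreover, $\rho(P,Q)=\rho_R(P,Q)$ for all $P,Q\in\mathcal P$. -/

import Mathlib

open Set Filter Topology MeasureTheory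
open scoped ENNReal

noncomputable section

namespace ProjectionSpace

variable {H : Type*} [NormedAddCommGroup H] [InnerProductSpace ℂ H] [CompleteSpace H]

variable (H) in
/-- The set `𝒫` of orthogonal projections `P = P* = P²` on the Hilbert space `H`, a subset of the
space of bounded operators with the operator norm. -/
def projections : Set (H →L[ℂ] H) := {P | IsStarProjection P}

/-- `γ : [a, b] → 𝒫` is a continuous path. Only the values of `γ` on `[a, b]` matter. -/
structure IsPath (γ : ℝ → H →L[ℂ] H) (a b : ℝ) : Prop where
  le : a ≤ b
  continuousOn : ContinuousOn γ (Icc a b)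
  mapsTo : MapsTo γ (Icc a b) (projections H)

/-- `γ : [a, b] → 𝒫` is a piecewise `C¹`-smooth path: there is a partition `a = t₀ < ⋯ < tₙ = b`
such that the restriction of `γ` to each closed interval `[tⱼ, tⱼ₊₁]` is `C¹`-smooth (with
one-sided derivatives at its ends). -/
structure IsPiecewiseC1Path (γ : ℝ → H →L[ℂ] H) (a b : ℝ) : Prop extends IsPath γ a b where
  exists_partition : ∃ (n : ℕ) (t : Fin (n + 1) → ℝ), StrictMono t ∧ t 0 = a ∧ t (Fin.last n) = b ∧
    ∀ j : Fin n, ContDiffOn ℝ 1 γ (Icc (t j.castSucc) (t j.succ))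

/-- The length of `γ : [a, b] → 𝒫`, the supremum over all partitions of `[a, b]` of
`∑ ‖γ (tⱼ₊₁) - γ (tⱼ)‖`, with values in `[0, ∞]`. -/
def length (γ : ℝ → H →L[ℂ] H) (a b : ℝ) : ℝ≥0∞ := eVariationOn γ (Icc a b)

/-- The Riemannian length `∫ₐᵇ ‖γ'(t)‖ dt`. For a piecewise `C¹`-smooth path on `[a, b]` the
derivative exists at all but finitely many points of `[a, b]`. -/
def riemannianLength (γ : ℝ → H →L[ℂ] H) (a b : ℝ) : ℝ≥0∞ := ∫⁻ t in Icc a b, ‖deriv γ t‖ₑ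

/-- The inner (length) metric `ρ`: the infimum of the lengths of rectifiable paths in `𝒫` from `P`
to `Q`, and `∞` if there are none. -/
def innerDist (P Q : H →L[ℂ] H) : ℝ≥0∞ :=
  sInf {l | ∃ (a b : ℝ) (γ : ℝ → H →L[ℂ] H), IsPath γ a b ∧ γ a = P ∧ γ b = Q ∧
    length γ a b < ∞ ∧ l = length γ a b}

/-- The Riemannian metric `ρ_R`: the infimum of the Riemannian lengths of piecewise `C¹`-smooth
paths in `𝒫` from `P` to `Q`, and `∞` if there are none. -/
def riemannianDist (P Q : H →L[ℂ] H) : ℝ≥0∞ :=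
  sInf {l | ∃ (a b : ℝ) (γ : ℝ → H →L[ℂ] H), IsPiecewiseC1Path γ a b ∧ γ a = P ∧ γ b = Q ∧
    l = riemannianLength γ a b}

end ProjectionSpace

end

noncomputable section

namespace ProjectionSpace

section Ring

variable {A : Type*} [Ring A]

/-- The element `K = (Q - P)(2P - 1)` attached to two projections; with the symmetries
`S = 2P - 1` and `R = 2Q - 1` one has `1 + 2K = RS`. -/
def transition (P Q : A) : A := (Q - P) * (2 * P - 1)

/-- A rational path from `P` to `Q`; it runs inside the set of projections if `‖P - Q‖ < 1`. -/
def rationalPath [Module ℝ A] (P Q : A) (t : ℝ) : A :=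
  1 - P + (1 + transition P Q) * Ring.inverse (1 + (1 - t) • transition P Q) * (2 * P - 1)

theorem symmetry_mul_self {P : A} (hP : P * P = P) : (2 * P - 1) * (2 * P - 1) = 1 := by
  have h : (2 * P - 1) * (2 * P - 1) = 4 * (P * P) - 4 * P + 1 := by noncomm_ring
  rw [h, hP, sub_self, zero_add]

theorem symmetry_mul_sub_add {P Q : A} (hP : P * P = P) (hQ : Q * Q = Q) :
    (Q - P) * (2 * P - 1) + (2 * P - 1) * (Q - P) = -2 * ((Q - P) * (Q - P)) := by
  have h : (Q - P) * (2 * P - 1) + (2 * P - 1) * (Q - P) =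
      2 * (Q * P) + 2 * (P * Q) - 4 * (P * P) - 2 * Q + 2 * P := by noncomm_ring
  have h' : -2 * ((Q - P) * (Q - P)) =
      2 * (Q * P) + 2 * (P * Q) - 2 * (P * P) - 2 * (Q * Q) := by noncomm_ring
  rw [h, h', hP, hQ]
  noncomm_ring

variable [StarRing A]

theorem star_symmetry {P : A} (hP : IsStarProjection P) : star (2 * P - 1) = 2 * P - 1 := by
  simp [hP.isSelfAdjoint.star_eq, two_mul]

theorem star_transition {P Q : A} (hP : IsStarProjection P) (hQ : IsStarProjection Q) :
    star (transition P Q) = (2 * P - 1) * (Q - P) := by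
  rw [transition, star_mul, star_symmetry hP, star_sub, hP.isSelfAdjoint.star_eq,
    hQ.isSelfAdjoint.star_eq]

theorem star_transition_eq_conj {P Q : A} (hP : IsStarProjection P) (hQ : IsStarProjection Q) :
    star (transition P Q) = (2 * P - 1) * transition P Q * (2 * P - 1) := by
  rw [star_transition hP hQ, transition]
  simp only [mul_assoc, symmetry_mul_self hP.isIdempotentElem.eq, mul_one]

theorem transition_mul_star {P Q : A} (hP : IsStarProjection P) (hQ : IsStarProjection Q) :
    transition P Q * star (transition P Q) = (Q - P) * (Q - P) := by
  rw [star_transition hP hQ, transition, mul_assoc, ← mul_assoc (2 * P - 1),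
    symmetry_mul_self hP.isIdempotentElem.eq, one_mul]

theorem transition_add_star {P Q : A} (hP : IsStarProjection P) (hQ : IsStarProjection Q) :
    transition P Q + star (transition P Q) = -2 * (transition P Q * star (transition P Q)) := by
  rw [transition_mul_star hP hQ, star_transition hP hQ, transition,
    symmetry_mul_sub_add hP.isIdempotentElem.eq hQ.isIdempotentElem.eq]

theorem commute_transition_star {P Q : A} (hP : IsStarProjection P) (hQ : IsStarProjection Q) :
    Commute (transition P Q) (star (transition P Q)) := by
  have hPP := hP.isIdempotentElem.eq
  have hQQ := hQ.isIdempotentElem.eq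
  have h : (2 * P - 1) * ((Q - P) * (Q - P)) = (Q - P) * (Q - P) * (2 * P - 1) := by
    have e : (Q - P) * (Q - P) = Q * Q - Q * P - P * Q + P * P := by noncomm_ring
    have e1 : (2 * P - 1) * (Q - Q * P - P * Q + P) =
      2 * (P * Q) - 2 * (P * Q * P) - 2 * (P * P * Q) + 2 * (P * P) - Q + Q * P + P * Q - P := by
      noncomm_ring
    have e2 : (Q - Q * P - P * Q + P) * (2 * P - 1) =
      2 * (Q * P) - 2 * (Q * (P * P)) - 2 * (P * Q * P) + 2 * (P * P) - Q + Q * P + P * Q - P := by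
      noncomm_ring
    rw [e, hPP, hQQ, e1, e2, hPP]
    noncomm_ring
  rw [commute_iff_eq, transition_mul_star hP hQ, star_transition hP hQ, transition]
  calc (Q - P) * (Q - P)
      = (Q - P) * (Q - P) * ((2 * P - 1) * (2 * P - 1)) := by
        rw [symmetry_mul_self hPP, mul_one]
    _ = (2 * P - 1) * ((Q - P) * (Q - P)) * (2 * P - 1) := by rw [h]; simp only [mul_assoc]
    _ = _ := by simp only [mul_assoc]

theorem isStarProjection_add_mul_symmetry {P W : A} (h2 : IsUnit (2 : A))
    (hP : IsStarProjection P) (hW : star W = (2 * P - 1) * W * (2 * P - 1))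
    (hWW : 2 * (W * star W) = W + star W) :
    IsStarProjection (1 - P + W * (2 * P - 1)) := by
  have hPP := hP.isIdempotentElem.eq
  have hSS := symmetry_mul_self hPP
  set S := 2 * P - 1 with hS
  have hT : W * S * (W * S) = W * star W := by rw [hW]; simp only [mul_assoc]
  have hST : S * (W * S) = star W := by rw [hW]; simp only [mul_assoc]
  have hTS : W * S * S = W := by rw [mul_assoc, hSS, mul_one]
  refine ⟨h2.mul_left_cancel ?_, ?_⟩
  · have e : 2 * ((1 - P + W * S) * (1 - P + W * S)) =
        1 + 1 - 4 * P + 2 * (P * P) + 4 * (W * S) - 2 * P * (W * S) - W * S * (2 * P)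
          + 2 * (W * S * (W * S)) := by noncomm_ring
    have hP2 : 2 * P = S + 1 := by rw [hS]; noncomm_ring
    have e' : 2 * P * (W * S) = star W + W * S := by rw [hP2, add_mul, hST, one_mul]
    have e'' : W * S * (2 * P) = W + W * S := by rw [hP2, mul_add, hTS, mul_one]
    rw [e, e', e'', hT, hWW, hPP, two_mul (1 - P + W * S)]
    noncomm_ring
  · rw [IsSelfAdjoint, star_add, star_sub, star_one, hP.isSelfAdjoint.star_eq, star_mul,
      star_symmetry hP, ← hS, ← hST, ← mul_assoc, hSS, one_mul]

theorem star_eq_conj_of_inverse {S N X : A} (hSS : S * S = 1) (hN : star N = S * N * S)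
    (hNX : N * X = 1) : star X = S * X * S := by
  have h : star X * star N = 1 := by rw [← star_mul, hNX, star_one]
  have h' : star N * (S * X * S) = 1 := by
    calc star N * (S * X * S) = S * (N * ((S * S) * X)) * S := by rw [hN]; simp only [mul_assoc]
      _ = 1 := by rw [hSS, one_mul, hNX, mul_one, hSS]
  exact left_inv_eq_right_inv h h'

theorem two_mul_mul_star_of_inverse {G N X : A} (hNX : N * X = 1) (hXN : X * N = 1)
    (hNN : Commute N (star N)) (hGN : Commute G N) (hGN' : Commute G (star N))
    (h : 2 * (G * star G) = G * star N + star G * N) :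
    2 * (G * X * star (G * X)) = G * X + star (G * X) := by
  have hNX' : star X * star N = 1 := by rw [← star_mul, hNX, star_one]
  have hXN' : star N * star X = 1 := by rw [← star_mul, hXN, star_one]
  let u : Aˣ := ⟨N, X, hNX, hXN⟩
  let v : Aˣ := ⟨star N, star X, hXN', hNX'⟩
  have hG'N : Commute (star G) N := by simpa using hGN'.star_star
  have hG'N' : Commute (star G) (star N) := hGN.star_star
  have c1 : Commute G X := hGN.units_inv_right (u := u)
  have c2 : Commute (star G) X := hG'N.units_inv_right (u := u)
  have c3 : Commute (star G) (star X) := hG'N'.units_inv_right (u := v)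
  have c4 : Commute (star N) X := hNN.symm.units_inv_right (u := u)
  have e1 : G * X * star (G * X) = G * star G * (X * star X) := by
    rw [star_mul, ← c3.eq, mul_assoc, ← mul_assoc X, ← c2.eq]; simp only [mul_assoc]
  have e2 : G * X = G * star N * (X * star X) := by
    rw [mul_assoc, ← mul_assoc (star N), c4.eq, mul_assoc X, hXN', mul_one]
  have e3 : star (G * X) = star G * N * (X * star X) := by
    rw [star_mul, ← c3.eq, mul_assoc, ← mul_assoc N, hNX, one_mul]
  rw [e1, ← mul_assoc, h, add_mul, ← e2, ← e3]

end Ring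

section Algebra

variable {A : Type*} [Ring A] [Algebra ℝ A]

theorem isUnit_two : IsUnit (2 : A) := by
  have := (IsUnit.mk0 (2 : ℝ) two_ne_zero).map (algebraMap ℝ A)
  rwa [map_ofNat] at this

theorem rationalPath_one {P Q : A} (hP : P * P = P) : rationalPath P Q 1 = Q := by
  have h : (2 * P - 1) + (Q - P) * ((2 * P - 1) * (2 * P - 1)) = Q - (1 - P) := by
    rw [symmetry_mul_self hP]; noncomm_ring
  rw [rationalPath, sub_self, zero_smul, add_zero, Ring.inverse_one, mul_one, transition, add_mul,
    one_mul, mul_assoc (Q - P), h, add_sub_cancel]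

theorem rationalPath_zero {P Q : A} (h : IsUnit (1 + transition P Q)) : rationalPath P Q 0 = P := by
  rw [rationalPath, sub_zero, one_smul, Ring.mul_inverse_cancel _ h]
  noncomm_ring

variable [StarRing A] [StarModule ℝ A]

theorem rationalPath_mem {P Q : A} (hP : IsStarProjection P) (hQ : IsStarProjection Q) {t : ℝ}
    (h : IsUnit (1 + (1 - t) • transition P Q)) : IsStarProjection (rationalPath P Q t) := by
  have hSS := symmetry_mul_self hP.isIdempotentElem.eq
  have hK := star_transition_eq_conj hP hQ
  have hKK := commute_transition_star hP hQ
  have hadd := transition_add_star hP hQ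
  have hNX := Ring.mul_inverse_cancel _ h
  have hXN := Ring.inverse_mul_cancel _ h
  unfold rationalPath
  set K := transition P Q
  set S := 2 * P - 1
  set s := 1 - t
  set X := Ring.inverse (1 + s • K)
  have hNs : star (1 + s • K) = 1 + s • star K := by simp
  have conj : ∀ r : ℝ, star (1 + r • K) = S * (1 + r • K) * S := by
    intro r
    simp [hK, mul_add, add_mul, hSS]
  have hGK : star (1 + K) = S * (1 + K) * S := by simpa using conj 1
  have cGN : Commute (1 + K) (1 + s • K) :=
    (Commute.one_right _).add_right (((Commute.one_left K).add_left (Commute.refl K)).smul_right s)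
  have cGN' : Commute (1 + K) (star (1 + s • K)) := by
    rw [hNs]
    exact (Commute.one_right _).add_right (((Commute.one_left _).add_left hKK).smul_right s)
  have cNN : Commute (1 + s • K) (star (1 + s • K)) := by
    rw [hNs]
    exact (Commute.one_right _).add_right
      (((Commute.one_left _).add_left (hKK.smul_left s)).smul_right s)
  have hX : star X = S * X * S := star_eq_conj_of_inverse hSS (conj s) hNX
  have cGX : Commute (1 + K) X :=
    cGN.units_inv_right (u := ⟨1 + s • K, X, hNX, hXN⟩)
  refine isStarProjection_add_mul_symmetry isUnit_two hP ?_
    (two_mul_mul_star_of_inverse hNX hXN cNN cGN cGN' ?_)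
  · rw [cGX.eq, star_mul, hX, hGK, ← cGX.eq]
    calc S * (1 + K) * S * (S * X * S) = S * (1 + K) * (S * S) * X * S := by
          simp only [mul_assoc]
      _ = S * ((1 + K) * X) * S := by rw [hSS, mul_one]; simp only [mul_assoc]
  · have e1 : 2 * ((1 + K) * star (1 + K)) =
        1 + 1 + (2 : ℝ) • (K + star K) + (2 : ℝ) • (K * star K) := by
      simp only [star_add, star_one, two_smul]; noncomm_ring
    have e2 : (1 + K) * star (1 + s • K) + star (1 + K) * (1 + s • K) =
        1 + 1 + (1 + s) • (K + star K) + (2 * s) • (K * star K) := by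
      rw [hNs, star_add, star_one]
      simp only [mul_add, add_mul, mul_one, one_mul, mul_smul_comm, ← hKK.eq]
      module
    have e3 : K + star K = (-2 : ℝ) • (K * star K) := by
      rw [hadd, neg_smul, two_smul]; noncomm_ring
    rw [e1, e2, e3]
    module

end Algebra

section Norm

theorem norm_one_le_one {A : Type*} [NormedRing A] [StarRing A] [CStarRing A] : ‖(1 : A)‖ ≤ 1 := by
  rcases subsingleton_or_nontrivial A with h | h
  · rw [Subsingleton.elim (1 : A) 0, norm_zero]; exact zero_le_one
  · exact CStarRing.norm_one.le

variable {A : Type*} [NormedRing A] [StarRing A] [CStarRing A]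

theorem norm_symmetry_le {P : A} (hP : IsStarProjection P) : ‖2 * P - 1‖ ≤ 1 := by
  have h : ‖2 * P - 1‖ * ‖2 * P - 1‖ ≤ 1 := by
    rw [← CStarRing.norm_star_mul_self, star_symmetry hP,
      symmetry_mul_self hP.isIdempotentElem.eq]
    exact norm_one_le_one
  nlinarith [norm_nonneg (2 * P - 1)]

theorem norm_transition_le {P Q : A} (hP : IsStarProjection P) :
    ‖transition P Q‖ ≤ ‖Q - P‖ :=
  (norm_mul_le _ _).trans (mul_le_of_le_one_right (norm_nonneg _) (norm_symmetry_le hP))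

theorem norm_inverse_one_add_le {x : A} {δ : ℝ} (hx : ‖x‖ ≤ δ) (hδ : δ < 1)
    (h : IsUnit (1 + x)) : ‖Ring.inverse (1 + x)‖ ≤ 1 / (1 - δ) := by
  set X := Ring.inverse (1 + x)
  have h1 : X = 1 - x * X := by
    have := Ring.mul_inverse_cancel _ h
    rw [add_mul, one_mul] at this
    exact eq_sub_of_add_eq this
  have h2 : ‖X‖ ≤ 1 + δ * ‖X‖ := by
    calc ‖X‖ = ‖1 - x * X‖ := by rw [← h1]
      _ ≤ ‖(1 : A)‖ + ‖x * X‖ := norm_sub_le _ _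
      _ ≤ 1 + δ * ‖X‖ := add_le_add norm_one_le_one
        ((norm_mul_le _ _).trans (mul_le_mul_of_nonneg_right hx (norm_nonneg _)))
  rw [le_div_iff₀ (by linarith)]
  linarith

variable [NormedAlgebra ℝ A]

theorem norm_smul_transition_le {P Q : A} (hP : IsStarProjection P) {t : ℝ}
    (ht : t ∈ Icc (0 : ℝ) 1) : ‖(1 - t) • transition P Q‖ ≤ ‖Q - P‖ := by
  rw [norm_smul, Real.norm_of_nonneg (sub_nonneg.2 ht.2)]
  exact (mul_le_of_le_one_left (norm_nonneg _) (by linarith [ht.1])).trans (norm_transition_le hP)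

variable [CompleteSpace A]

theorem isUnit_one_add_smul_transition {P Q : A} (hP : IsStarProjection P) (hPQ : ‖Q - P‖ < 1)
    {t : ℝ} (ht : t ∈ Icc (0 : ℝ) 1) : IsUnit (1 + (1 - t) • transition P Q) := by
  have := isUnit_one_sub_of_norm_lt_one (x := -((1 - t) • transition P Q))
    (by rw [norm_neg]; exact (norm_smul_transition_le hP ht).trans_lt hPQ)
  rwa [sub_neg_eq_add] at this

theorem rationalPath_zero_of_lt {P Q : A} (hP : IsStarProjection P) (hPQ : ‖Q - P‖ < 1) :
    rationalPath P Q 0 = P :=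
  rationalPath_zero (by
    simpa using isUnit_one_add_smul_transition hP hPQ (left_mem_Icc.2 zero_le_one))

theorem contDiffAt_rationalPath {P Q : A} (hP : IsStarProjection P) (hPQ : ‖Q - P‖ < 1)
    {t : ℝ} (ht : t ∈ Icc (0 : ℝ) 1) : ContDiffAt ℝ 1 (rationalPath P Q) t := by
  obtain ⟨u, hu⟩ := isUnit_one_add_smul_transition hP hPQ ht
  have h : ContDiffAt ℝ 1 (fun t : ℝ => Ring.inverse (1 + (1 - t) • transition P Q)) t := by
    refine ContDiffAt.comp t (g := Ring.inverse) ?_ (by fun_prop)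
    rw [← hu]
    exact contDiffAt_ringInverse ℝ u
  exact contDiffAt_const.add ((contDiffAt_const.mul h).mul contDiffAt_const)

theorem hasDerivAt_rationalPath {P Q : A} (hP : IsStarProjection P) (hPQ : ‖Q - P‖ < 1)
    {t : ℝ} (ht : t ∈ Icc (0 : ℝ) 1) :
    HasDerivAt (rationalPath P Q)
      ((1 + transition P Q) * (Ring.inverse (1 + (1 - t) • transition P Q) * transition P Q *
        Ring.inverse (1 + (1 - t) • transition P Q)) * (2 * P - 1)) t := by
  obtain ⟨u, hu⟩ := isUnit_one_add_smul_transition hP hPQ ht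
  have h1 : HasDerivAt (fun t : ℝ => 1 + (1 - t) • transition P Q) (-transition P Q) t := by
    simpa using (((hasDerivAt_id t).const_sub 1).smul_const (transition P Q)).const_add 1
  have h2 := hasFDerivAt_ringInverse (𝕜 := ℝ) u
  rw [← Ring.inverse_unit, hu] at h2
  have h := ((h2.comp_hasDerivAt t h1).const_mul (1 + transition P Q)).mul_const (2 * P - 1)
  unfold rationalPath
  simpa using h.const_add (1 - P)

/-- The speed of the rational path exceeds `‖Q - P‖` by a factor close to one only. -/
theorem norm_deriv_rationalPath_le {P Q : A} (hP : IsStarProjection P) {δ : ℝ} (hδ : δ < 1)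
    (hPQ : ‖Q - P‖ ≤ δ) {t : ℝ} (ht : t ∈ Icc (0 : ℝ) 1) :
    ‖deriv (rationalPath P Q) t‖ ≤ (1 + δ) / (1 - δ) ^ 2 * ‖Q - P‖ := by
  have hlt := hPQ.trans_lt hδ
  rw [(hasDerivAt_rationalPath hP hlt ht).deriv]
  have hX := norm_inverse_one_add_le ((norm_smul_transition_le hP ht).trans hPQ) hδ
    (isUnit_one_add_smul_transition hP hlt ht)
  set X := Ring.inverse (1 + (1 - t) • transition P Q)
  have hK := norm_transition_le (Q := Q) hP
  have hδ0 : 0 ≤ δ := (norm_nonneg _).trans hPQ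
  have hG : ‖1 + transition P Q‖ ≤ 1 + δ :=
    (norm_add_le _ _).trans (add_le_add norm_one_le_one (hK.trans hPQ))
  have hd : 0 ≤ 1 / (1 - δ) := by have := sub_pos.2 hδ; positivity
  calc _ ≤ ‖1 + transition P Q‖ * (‖X‖ * ‖transition P Q‖ * ‖X‖) * ‖2 * P - 1‖ := by
        refine (norm_mul_le _ _).trans (mul_le_mul_of_nonneg_right ?_ (norm_nonneg _))
        refine (norm_mul_le _ _).trans (mul_le_mul_of_nonneg_left ?_ (norm_nonneg _))
        exact (norm_mul_le _ _).trans (mul_le_mul_of_nonneg_right (norm_mul_le _ _) (norm_nonneg _))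
    _ ≤ (1 + δ) * (1 / (1 - δ) * ‖Q - P‖ * (1 / (1 - δ))) * 1 := by
        gcongr
        exact norm_symmetry_le hP
    _ = _ := by field_simp

theorem norm_rationalPath_sub_le {P Q : A} (hP : IsStarProjection P) {δ : ℝ} (hδ : δ < 1)
    (hPQ : ‖Q - P‖ ≤ δ) {t : ℝ} (ht : t ∈ Icc (0 : ℝ) 1) :
    ‖rationalPath P Q t - P‖ ≤ (1 + δ) / (1 - δ) ^ 2 * ‖Q - P‖ := by
  have hlt := hPQ.trans_lt hδ
  have hδ0 : 0 ≤ δ := (norm_nonneg _).trans hPQ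
  have := Convex.norm_image_sub_le_of_norm_deriv_le (𝕜 := ℝ)
    (fun x hx => (hasDerivAt_rationalPath hP hlt hx).differentiableAt)
    (fun x hx => norm_deriv_rationalPath_le hP hδ hPQ hx) (convex_Icc (0 : ℝ) 1)
    (left_mem_Icc.2 zero_le_one) ht
  rw [rationalPath_zero_of_lt hP hlt, sub_zero, Real.norm_of_nonneg ht.1] at this
  exact this.trans (mul_le_of_le_one_right (by positivity) ht.2)

end Norm

section Variation

theorem eVariationOn_le_lintegral_enorm_deriv {E : Type*} [NormedAddCommGroup E] [NormedSpace ℝ E]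
    [CompleteSpace E] {f : ℝ → E} {a b : ℝ} {s : Set ℝ} (hs : s.Countable)
    (hc : ContinuousOn f (Icc a b)) (hd : ∀ x ∈ Ioo a b \ s, DifferentiableAt ℝ f x) :
    eVariationOn f (Icc a b) ≤ ∫⁻ t in Icc a b, ‖deriv f t‖ₑ := by
  by_cases htop : ∫⁻ t in Icc a b, ‖deriv f t‖ₑ = ∞
  · rw [htop]; exact le_top
  have hint : IntegrableOn (deriv f) (Icc a b) :=
    ⟨aestronglyMeasurable_deriv f _, lt_top_iff_ne_top.2 htop⟩
  refine iSup_le ?_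
  rintro ⟨n, u, hu, us⟩
  have key : ∀ i, edist (f (u (i + 1))) (f (u i)) ≤ ∫⁻ t in Ioc (u i) (u (i + 1)), ‖deriv f t‖ₑ := by
    intro i
    have hle : u i ≤ u (i + 1) := hu i.le_succ
    have hsub : Icc (u i) (u (i + 1)) ⊆ Icc a b := Icc_subset_Icc (us i).1 (us (i + 1)).2
    have h := integral_eq_of_hasDerivAt_off_countable_of_le f (deriv f) hle hs (hc.mono hsub)
      (fun x hx => (hd x ⟨Ioo_subset_Ioo (us i).1 (us (i + 1)).2 hx.1, hx.2⟩).hasDerivAt)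
      ((intervalIntegrable_iff_integrableOn_Icc_of_le hle).2 (hint.mono_set hsub))
    rw [edist_eq_enorm_sub, ← h, intervalIntegral.integral_of_le hle]
    exact enorm_integral_le_lintegral_enorm _
  calc ∑ i ∈ Finset.range n, edist (f (u (i + 1))) (f (u i))
      ≤ ∑ i ∈ Finset.range n, ∫⁻ t in Ioc (u i) (u (i + 1)), ‖deriv f t‖ₑ :=
        Finset.sum_le_sum fun i _ => key i
    _ = ∫⁻ t in ⋃ i ∈ Finset.range n, Ioc (u i) (u (i + 1)), ‖deriv f t‖ₑ :=
        (lintegral_biUnion_finset (fun i _ j _ hij => hu.pairwise_disjoint_on_Ioc_succ hij)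
          (fun i _ => measurableSet_Ioc) _).symm
    _ ≤ _ := lintegral_mono_set <| iUnion₂_subset fun i _ =>
        Ioc_subset_Icc_self.trans (Icc_subset_Icc (us i).1 (us (i + 1)).2)

end Variation

section Chain

variable {A : Type*} [NormedRing A] [StarRing A] [CStarRing A] [CompleteSpace A]
  [NormedAlgebra ℝ A]

/-- The concatenation of the rational paths from `u j` to `u (j + 1)`, each of them run through on
the interval `[a + j h, a + (j + 1) h]`. -/
def chainPath {A : Type*} [Ring A] [Module ℝ A] (u : ℕ → A) (a h t : ℝ) : A :=
  rationalPath (u ⌊(t - a) / h⌋₊) (u (⌊(t - a) / h⌋₊ + 1)) ((t - a) / h - ⌊(t - a) / h⌋₊)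

variable {u : ℕ → A} {a h δ : ℝ}

theorem div_sub_mem_Icc (hh : 0 < h) {j : ℕ} {t : ℝ} (ht : t ∈ Icc (a + j * h) (a + (j + 1) * h)) :
    (t - a) / h - j ∈ Icc (0 : ℝ) 1 := by
  constructor
  · rw [sub_nonneg, le_div_iff₀ hh]; linarith [ht.1]
  · rw [sub_le_iff_le_add, div_le_iff₀ hh]; linarith [ht.2]

theorem chainPath_eqOn (hu : ∀ j, IsStarProjection (u j)) (hlt : ∀ j, ‖u (j + 1) - u j‖ < 1)
    (hh : 0 < h) (j : ℕ) :
    EqOn (chainPath u a h) (fun t => rationalPath (u j) (u (j + 1)) ((t - a) / h - j))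
      (Icc (a + j * h) (a + (j + 1) * h)) := by
  intro t ht
  have hm := div_sub_mem_Icc hh ht
  rcases hm.2.lt_or_eq with h1 | h1
  · have hf : ⌊(t - a) / h⌋₊ = j :=
      (Nat.floor_eq_iff (by linarith [hm.1, j.cast_nonneg (α := ℝ)])).2
        ⟨by linarith [hm.1], by linarith⟩
    simp only [chainPath, hf]
  · have hx : (t - a) / h = ((j + 1 : ℕ) : ℝ) := by push_cast; linarith
    have h0 : (t - a) / h - j = 1 := h1
    simp only [chainPath, h0]
    rw [hx, Nat.floor_natCast, sub_self, rationalPath_zero_of_lt (hu _) (hlt _),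
      rationalPath_one (hu j).isIdempotentElem.eq]

theorem chainPath_node (hu : ∀ j, IsStarProjection (u j)) (hlt : ∀ j, ‖u (j + 1) - u j‖ < 1)
    (hh : 0 < h) (j : ℕ) : chainPath u a h (a + j * h) = u j := by
  have : (a + j * h - a) / h = j := by field_simp; ring
  rw [chainPath, this, Nat.floor_natCast, sub_self, rationalPath_zero_of_lt (hu _) (hlt _)]

theorem sub_floor_mem_Icc (hh : 0 < h) {t : ℝ} (ht : a ≤ t) :
    (t - a) / h - ⌊(t - a) / h⌋₊ ∈ Icc (0 : ℝ) 1 :=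
  ⟨sub_nonneg.2 (Nat.floor_le (div_nonneg (sub_nonneg.2 ht) hh.le)),
    by linarith [Nat.lt_floor_add_one ((t - a) / h)]⟩

theorem chainPath_mem [StarModule ℝ A] (hu : ∀ j, IsStarProjection (u j))
    (hlt : ∀ j, ‖u (j + 1) - u j‖ < 1) (hh : 0 < h) {t : ℝ} (ht : a ≤ t) :
    IsStarProjection (chainPath u a h t) :=
  rationalPath_mem (hu _) (hu _)
    (isUnit_one_add_smul_transition (hu _) (hlt _) (sub_floor_mem_Icc hh ht))

theorem norm_chainPath_sub_le (hu : ∀ j, IsStarProjection (u j)) (hδ : δ < 1)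
    (hle : ∀ j, ‖u (j + 1) - u j‖ ≤ δ) (hh : 0 < h) {t : ℝ} (ht : a ≤ t) :
    ‖chainPath u a h t - u ⌊(t - a) / h⌋₊‖ ≤ (1 + δ) / (1 - δ) ^ 2 * δ := by
  have hδ0 : 0 ≤ δ := (norm_nonneg _).trans (hle 0)
  exact (norm_rationalPath_sub_le (hu _) hδ (hle _) (sub_floor_mem_Icc hh ht)).trans
    (mul_le_mul_of_nonneg_left (hle _) (by positivity))

theorem contDiffOn_chainPath (hu : ∀ j, IsStarProjection (u j))
    (hlt : ∀ j, ‖u (j + 1) - u j‖ < 1) (hh : 0 < h) (j : ℕ) :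
    ContDiffOn ℝ 1 (chainPath u a h) (Icc (a + j * h) (a + (j + 1) * h)) := by
  refine ContDiffOn.congr (fun t ht => ContDiffAt.contDiffWithinAt ?_) (chainPath_eqOn hu hlt hh j)
  exact ContDiffAt.comp t (f := fun t => (t - a) / h - j)
    (contDiffAt_rationalPath (hu j) (hlt j) (div_sub_mem_Icc hh ht)) (by fun_prop)

theorem continuousOn_chainPath (hu : ∀ j, IsStarProjection (u j))
    (hlt : ∀ j, ‖u (j + 1) - u j‖ < 1) (hh : 0 < h) (n : ℕ) :
    ContinuousOn (chainPath u a h) (Icc a (a + n * h)) := by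
  induction n with
  | zero => simp
  | succ n ih =>
    have := ih.union_of_isClosed (contDiffOn_chainPath (a := a) hu hlt hh n).continuousOn
      isClosed_Icc isClosed_Icc
    rw [Icc_union_Icc_eq_Icc (by simp; positivity) (by gcongr; simp)] at this
    simpa using this

theorem enorm_deriv_chainPath_le (hu : ∀ j, IsStarProjection (u j)) (hδ : δ < 1)
    (hle : ∀ j, ‖u (j + 1) - u j‖ ≤ δ) (hh : 0 < h) {j : ℕ} {t : ℝ}
    (ht : t ∈ Ioo (a + j * h) (a + (j + 1) * h)) :
    ‖deriv (chainPath u a h) t‖ₑ ≤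
      ENNReal.ofReal ((1 + δ) / (1 - δ) ^ 2 * ‖u (j + 1) - u j‖ / h) := by
  have hlt : ∀ j, ‖u (j + 1) - u j‖ < 1 := fun j => (hle j).trans_lt hδ
  have hm := div_sub_mem_Icc hh (Ioo_subset_Icc_self ht)
  have he : chainPath u a h =ᶠ[𝓝 t] fun t => rationalPath (u j) (u (j + 1)) ((t - a) / h - j) :=
    ((chainPath_eqOn hu hlt hh j).mono Ioo_subset_Icc_self).eventuallyEq_of_mem
      (isOpen_Ioo.mem_nhds ht)
  have h1 : HasDerivAt (fun t : ℝ => (t - a) / h - j) h⁻¹ t := by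
    simpa using (((hasDerivAt_id t).sub_const a).div_const h).sub_const (j : ℝ)
  have h2 := (hasDerivAt_rationalPath (hu j) (hlt j) hm).differentiableAt.hasDerivAt.scomp t h1
  have h3 : deriv (fun t => rationalPath (u j) (u (j + 1)) ((t - a) / h - j)) t = _ := h2.deriv
  rw [he.deriv_eq, h3, ← ofReal_norm, norm_smul, norm_inv, Real.norm_of_nonneg hh.le,
    inv_mul_eq_div]
  refine ENNReal.ofReal_le_ofReal (div_le_div_of_nonneg_right ?_ hh.le)
  exact norm_deriv_rationalPath_le (hu j) hδ (hle j) hm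

theorem lintegral_enorm_deriv_chainPath_le (hu : ∀ j, IsStarProjection (u j)) (hδ : δ < 1)
    (hle : ∀ j, ‖u (j + 1) - u j‖ ≤ δ) (hh : 0 < h) (n : ℕ) :
    ∫⁻ t in Icc a (a + n * h), ‖deriv (chainPath u a h) t‖ₑ ≤
      ENNReal.ofReal ((1 + δ) / (1 - δ) ^ 2) * ∑ j ∈ Finset.range n, edist (u (j + 1)) (u j) := by
  have hδ0 : 0 ≤ δ := (norm_nonneg _).trans (hle 0)
  induction n with
  | zero => simp
  | succ n ih =>
    have hsub : Icc a (a + (n + 1 : ℕ) * h) ⊆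
        Icc a (a + n * h) ∪ Icc (a + n * h) (a + (n + 1) * h) := by
      rw [Icc_union_Icc_eq_Icc (by simp; positivity) (by gcongr; simp)]
      simp
    rw [Finset.sum_range_succ, mul_add]
    refine (lintegral_mono_set hsub).trans ((lintegral_union_le _ _ _).trans (add_le_add ih ?_))
    rw [← setLIntegral_congr Ioo_ae_eq_Icc]
    refine (setLIntegral_mono' measurableSet_Ioo
      fun t ht => enorm_deriv_chainPath_le hu hδ hle hh ht).trans ?_
    rw [setLIntegral_const, Real.volume_Ioo, edist_eq_enorm_sub, ← ofReal_norm,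
      ← ENNReal.ofReal_mul (by positivity), ← ENNReal.ofReal_mul (by positivity)]
    refine ENNReal.ofReal_le_ofReal (le_of_eq ?_)
    field_simp
    ring

end Chain

section Paths

variable {H : Type*} [NormedAddCommGroup H] [InnerProductSpace ℂ H] [CompleteSpace H]

theorem IsPiecewiseC1Path.length_le_riemannianLength {γ : ℝ → H →L[ℂ] H} {a b : ℝ}
    (hγ : IsPiecewiseC1Path γ a b) : length γ a b ≤ riemannianLength γ a b := by
  obtain ⟨n, t, -, ht0, htn, hc⟩ := hγ.exists_partition
  refine eVariationOn_le_lintegral_enorm_deriv (Set.finite_range t).countable hγ.continuousOn ?_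
  rintro x ⟨hx, hxt⟩
  obtain ⟨j, hj⟩ : ∃ j : Fin n, x ∈ Ioo (t j.castSucc) (t j.succ) := by
    by_contra! hne
    have hlt : ∀ i : Fin (n + 1), t i < x := by
      intro i
      induction i using Fin.induction with
      | zero => rw [ht0]; exact hx.1
      | succ i ih =>
        refine lt_of_le_of_ne (not_lt.1 fun h => hne i ⟨ih, h⟩) fun h => hxt ⟨_, h⟩
    exact absurd (htn ▸ hlt (Fin.last n)) (not_lt.2 hx.2.le)
  exact ((hc j).contDiffAt (Icc_mem_nhds hj.1 hj.2)).differentiableAt one_ne_zero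

/-- Approximation of a path by piecewise smooth paths, with control of the Riemannian length. -/
theorem IsPath.exists_approx {γ : ℝ → H →L[ℂ] H} {a b : ℝ} (hγ : IsPath γ a b) {δ : ℝ}
    (hδ0 : 0 < δ) (hδ : δ < 1) :
    ∃ g : ℝ → H →L[ℂ] H, IsPiecewiseC1Path g a b ∧ g a = γ a ∧ g b = γ b ∧
      (∀ t ∈ Icc a b, ‖g t - γ t‖ ≤ (1 + δ) / (1 - δ) ^ 2 * δ + δ) ∧
      riemannianLength g a b ≤ ENNReal.ofReal ((1 + δ) / (1 - δ) ^ 2) * length γ a b := by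
  rcases hγ.le.eq_or_lt with rfl | hab
  · refine ⟨γ, ⟨hγ, 0, fun _ => a, ?_, rfl, rfl, fun j => j.elim0⟩, rfl, rfl, ?_, ?_⟩
    · exact fun i j hij => absurd hij (by omega)
    · intro t _
      rw [sub_self, norm_zero]
      positivity
    · simp [riemannianLength]
  · obtain ⟨ε, hε, hγε⟩ := Metric.uniformContinuousOn_iff_le.1
      (isCompact_Icc.uniformContinuousOn_of_continuous hγ.continuousOn) δ hδ0
    obtain ⟨N, hN⟩ := exists_nat_gt ((b - a) / ε)
    have hba : 0 < b - a := sub_pos.2 hab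
    have hN0 : (0 : ℝ) < N := (div_pos hba hε).trans hN
    set h := (b - a) / N with hh_def
    have hh : 0 < h := div_pos hba hN0
    have hhε : h ≤ ε := by
      rw [div_lt_iff₀ hε] at hN
      rw [hh_def, div_le_iff₀ hN0]; linarith
    have hNh : a + N * h = b := by rw [hh_def]; field_simp; ring
    let τ : ℕ → ℝ := fun j => min (a + j * h) b
    have hτ : ∀ j, τ j ∈ Icc a b := fun j => ⟨le_min (by simp; positivity) hab.le, min_le_right _ _⟩
    have hτm : Monotone τ := fun i j hij => min_le_min_right _ (by gcongr)
    have hτd : ∀ j, dist (τ (j + 1)) (τ j) ≤ ε := by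
      intro j
      rw [Real.dist_eq]
      refine (abs_min_sub_min_le_max _ _ _ _).trans ?_
      simp only [sub_self, abs_zero, max_le_iff]
      refine ⟨?_, hε.le⟩
      push_cast
      rw [show a + (j + 1) * h - (a + j * h) = h by ring, abs_of_pos hh]
      exact hhε
    have hτN : ∀ j ≤ N, τ j = a + j * h := by
      intro j hj
      refine min_eq_left ?_
      rw [← hNh]; gcongr
    let u : ℕ → H →L[ℂ] H := fun j => γ (τ j)
    have hu : ∀ j, IsStarProjection (u j) := fun j => hγ.mapsTo (hτ j)
    have hle : ∀ j, ‖u (j + 1) - u j‖ ≤ δ := fun j => by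
      rw [← dist_eq_norm]; exact hγε _ (hτ _) _ (hτ _) (hτd j)
    have hlt : ∀ j, ‖u (j + 1) - u j‖ < 1 := fun j => (hle j).trans_lt hδ
    have hnode := chainPath_node (a := a) hu hlt hh
    refine ⟨chainPath u a h, ⟨⟨hab.le, ?_, fun t ht => chainPath_mem hu hlt hh ht.1⟩, N,
      fun j => a + (j : ℕ) * h, ?_, ?_, ?_, fun j => ?_⟩, ?_, ?_, fun t ht => ?_, ?_⟩
    · rw [← hNh]; exact continuousOn_chainPath hu hlt hh N
    · intro i j hij
      have : ((i : ℕ) : ℝ) < (j : ℕ) := by exact_mod_cast hij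
      simp only
      gcongr
    · simp
    · simpa using hNh
    · simpa using contDiffOn_chainPath (a := a) hu hlt hh j
    · have := hnode 0
      simpa [u, hτN] using this
    · have := hnode N
      rw [hNh] at this
      rw [this]
      simp only [u, hτN N le_rfl, hNh]
    · refine (norm_sub_le_norm_sub_add_norm_sub _ (u ⌊(t - a) / h⌋₊) _).trans
        (add_le_add (norm_chainPath_sub_le hu hδ hle hh ht.1) ?_)
      rw [← dist_eq_norm]
      refine hγε _ (hτ _) _ ht ?_
      have hm := sub_floor_mem_Icc hh ht.1
      have h1 : a + ⌊(t - a) / h⌋₊ * h ≤ t := by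
        have := mul_le_mul_of_nonneg_right (sub_nonneg.1 hm.1) hh.le
        rw [div_mul_cancel₀ _ hh.ne'] at this; linarith
      have h2 : t ≤ a + ⌊(t - a) / h⌋₊ * h + h := by
        have := mul_le_mul_of_nonneg_right hm.2 hh.le
        rw [sub_mul, div_mul_cancel₀ _ hh.ne'] at this; linarith
      simp only [τ]
      rw [min_eq_left (h1.trans ht.2), Real.dist_eq, abs_le]
      constructor <;> linarith
    · have := lintegral_enorm_deriv_chainPath_le (a := a) hu hδ hle hh N
      rw [hNh] at this
      exact this.trans (mul_le_mul_right (eVariationOn.sum_le hτm hτ) _)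

theorem tendsto_one_div_add_two : Tendsto (fun n : ℕ => 1 / ((n : ℝ) + 2)) atTop (𝓝 0) := by
  simpa [Function.comp_def] using
    (tendsto_one_div_atTop_nhds_zero_nat (𝕜 := ℝ)).comp (tendsto_add_atTop_nat 2)

theorem tendsto_speed_factor :
    Tendsto (fun n : ℕ => (1 + 1 / ((n : ℝ) + 2)) / (1 - 1 / ((n : ℝ) + 2)) ^ 2) atTop (𝓝 1) := by
  have h : ContinuousAt (fun x : ℝ => (1 + x) / (1 - x) ^ 2) 0 :=
    ContinuousAt.div (by fun_prop) (by fun_prop) (by simp)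
  simpa [ContinuousAt, Function.comp_def] using h.tendsto.comp tendsto_one_div_add_two

theorem IsPath.exists_seq_approx {γ : ℝ → H →L[ℂ] H} {a b : ℝ} (hγ : IsPath γ a b) :
    ∃ γn : ℕ → ℝ → H →L[ℂ] H,
      (∀ n, IsPiecewiseC1Path (γn n) a b ∧ γn n a = γ a ∧ γn n b = γ b) ∧
      TendstoUniformlyOn γn γ atTop (Icc a b) ∧
      ∃ c : ℕ → ℝ≥0∞, Tendsto c atTop (𝓝 1) ∧
        ∀ n, riemannianLength (γn n) a b ≤ c n * length γ a b := by
  have hδ0 : ∀ n : ℕ, (0 : ℝ) < 1 / ((n : ℝ) + 2) := fun n => by positivity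
  have hδ1 : ∀ n : ℕ, 1 / ((n : ℝ) + 2) < 1 := fun n => by
    rw [div_lt_one (by positivity)]; linarith [n.cast_nonneg (α := ℝ)]
  choose g hg ha hb hd hl using fun n : ℕ => hγ.exists_approx (hδ0 n) (hδ1 n)
  refine ⟨g, fun n => ⟨hg n, ha n, hb n⟩, ?_, _, ?_, hl⟩
  · rw [Metric.tendstoUniformlyOn_iff]
    intro ε hε
    have h3 := (tendsto_speed_factor.mul tendsto_one_div_add_two).add tendsto_one_div_add_two
    rw [mul_zero, add_zero] at h3
    filter_upwards [h3.eventually (gt_mem_nhds hε)] with n hn t ht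
    rw [dist_comm, dist_eq_norm]
    exact (hd n t ht).trans_lt hn
  · simpa using ENNReal.tendsto_ofReal tendsto_speed_factor

theorem tendsto_length_of_riemannianLength_le {γ : ℝ → H →L[ℂ] H} {γn : ℕ → ℝ → H →L[ℂ] H}
    {a b : ℝ} (hγn : ∀ n, IsPiecewiseC1Path (γn n) a b)
    (hlim : TendstoUniformlyOn γn γ atTop (Icc a b)) {c : ℕ → ℝ≥0∞} (hc : Tendsto c atTop (𝓝 1))
    (hl : ∀ n, riemannianLength (γn n) a b ≤ c n * length γ a b) :
    Tendsto (fun n => length (γn n) a b) atTop (𝓝 (length γ a b)) := by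
  have hcl : Tendsto (fun n => c n * length γ a b) atTop (𝓝 (length γ a b)) := by
    simpa using ENNReal.Tendsto.mul_const hc (Or.inl one_ne_zero)
  refine tendsto_order.2 ⟨fun v hv => ?_, fun v hv => ?_⟩
  · exact eVariationOn.lowerSemicontinuous_aux (fun x hx => hlim.tendsto_at hx) hv
  · filter_upwards [hcl.eventually (gt_mem_nhds hv)] with n hn
    exact ((hγn n).length_le_riemannianLength.trans (hl n)).trans_lt hn

theorem innerDist_le_riemannianDist (P Q : H →L[ℂ] H) : innerDist P Q ≤ riemannianDist P Q := by
  refine le_sInf ?_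
  rintro l ⟨a, b, γ, hγ, rfl, rfl, rfl⟩
  rcases eq_or_ne (riemannianLength γ a b) ∞ with h | h
  · rw [h]; exact le_top
  · have hle := hγ.length_le_riemannianLength
    refine le_trans (sInf_le ?_) hle
    exact ⟨a, b, γ, hγ.toIsPath, rfl, rfl, hle.trans_lt (lt_top_iff_ne_top.2 h), rfl⟩

theorem riemannianDist_le_innerDist (P Q : H →L[ℂ] H) : riemannianDist P Q ≤ innerDist P Q := by
  refine le_sInf ?_
  rintro l ⟨a, b, γ, hγ, rfl, rfl, -, rfl⟩
  obtain ⟨g, hg, -, c, hc, hl⟩ := hγ.exists_seq_approx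
  have hcl : Tendsto (fun n => c n * length γ a b) atTop (𝓝 (length γ a b)) := by
    simpa using ENNReal.Tendsto.mul_const hc (Or.inl one_ne_zero)
  refine ge_of_tendsto' hcl fun n => le_trans (sInf_le ?_) (hl n)
  exact ⟨a, b, g n, (hg n).1, (hg n).2.1, (hg n).2.2, rfl⟩

end Paths

end ProjectionSpace

end

theorem lemma4p1 {H : Type*} [NormedAddCommGroup H] [InnerProductSpace ℂ H] [CompleteSpace H] :
    (∀ (a b : ℝ) (γ : ℝ → H →L[ℂ] H), ProjectionSpace.IsPath γ a b →
      ∃ γn : ℕ → ℝ → H →L[ℂ] H,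
        (∀ n, ProjectionSpace.IsPiecewiseC1Path (γn n) a b ∧ γn n a = γ a ∧ γn n b = γ b) ∧
        TendstoUniformlyOn γn γ atTop (Icc a b) ∧
        Tendsto (fun n => ProjectionSpace.length (γn n) a b) atTop
          (𝓝 (ProjectionSpace.length γ a b))) ∧
    (∀ P ∈ ProjectionSpace.projections H, ∀ Q ∈ ProjectionSpace.projections H,
      ProjectionSpace.innerDist P Q = ProjectionSpace.riemannianDist P Q) := by
  refine ⟨fun a b γ hγ => ?_, fun P _ Q _ =>
    le_antisymm (ProjectionSpace.innerDist_le_riemannianDist P Q)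
      (ProjectionSpace.riemannianDist_le_innerDist P Q)⟩
  obtain ⟨γn, h, hlim, c, hc, hl⟩ := hγ.exists_seq_approx
  exact ⟨γn, h, hlim,
    ProjectionSpace.tendsto_length_of_riemannianLength_le (fun n => (h n).1) hlim hc hl⟩
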